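/- Let $(W,S)$ be a Coxeter system with $S$ finite and length function $\ell$, let $\Bbbk$ be a noetherian integral domain, and let $V$ be a free $\Bbbk$-module of finite rank with a $\Bbbk$-linear action of $W$ and elements $\alpha_s\in V$, $\alpha_s^\vee\in V^*=\mathrm{Hom}_{\Bbbk}(V,\Bbbk)$ $(s\in S)$ such that $\langle\alpha_s^\vee,\alpha_s\rangle=2$, $s(v)=v-\langle\alpha_s^\vee,v\rangle\alpha_s$ for $v\in V$, $\alpha_s^\vee\colon V\to\Bbbk$ is surjective, and $\alpha_s\neq0$. Let $R=S(V)$ be the symmetric algebra, graded with $\deg V=2$, with fraction field $Q$, let $R^s$ be the ring of $s$-invariants, $\partial_s(f)=(f-s(f))/\alpha_s$, and $B_s=R\otimes_{R^s}R(1)$. For a word $\underline{x}=(s_1,\dots,s_l)$ in $S$ put $$B_{\underline{x}}=B_{s_1}\otimes_R\cdots\otimes_R B_{s_l}=R\otimes_{R^{s_1}}R\otimes_{R^{s_2}}\cdots\otimes_{R^{s_l}}R,\qquad u_{\underline{x}}=(1\otimes1)\otimes\cdots\otimes(1\otimes1)\in B_{\underline{x}} .$$ For each $s$ one has $B_s\otimes_RQ=(B_s)_Q^e\oplus(B_s)_Q^s$,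 where $(B_s)_Q^e$ is spanned by $\delta\otimes1-1\otimes s(\delta)$ and $(B_s)_Q^s$ by $\delta\otimes1-1\otimes\delta$ for any $\delta\in V$ with $\langle\alpha_s^\vee,\delta\rangle=1$; taking tensor products and multiplying the indices in $W$ gives $B_{\underline{x}}\otimes_RQ=\bigoplus_{w\in W}(B_{\underline{x}})_Q^w$. By a degree-zero morphism in $\mathcal{C}$ between two such bimodules we mean a homomorphism of graded $R$-bimodules of degree $0$ which after $\otimes_RQ$ respects these decompositions. Assume that for all $s\neq t$ in $S$ such that $st$ has finite order $m$ there is a degree-zero morphism $B_{(s,t,\dots)}\to B_{(t,s,\dots)}$ in $\mathcal{C}$ (both words of length $m$) which sends $u_{(s,t,\dots)}$ to $u_{(t,s,\dots)}$, and fix one such morphism for each $(s,t)$. A map $\mathrm{rex}\colon B_{\underline{y}}\to B_{\underline{y}'}$ between reduced expressions of the same element is any composite of the fixed morphisms, tensored with identities on both sides, along a (possibly empty) sequence of braid relations from $\underline{y}$ to $\underline{y}'$. For a subexpression $\boldsymbol{e}\in\{0,1\}^l$ of $\underline{x}$ let $w_i=s_1^{\boldsymbol{e}_1}\cdots s_i^{\boldsymbol{e}_i}$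 and $\underline{x}^{\boldsymbol{e}}=w_l$. The label of $\boldsymbol{e}$ at $i$ is $U$ if $w_{i-1}s_i>w_{i-1}$, and $D$ otherwise. A light leaf $LL_{\underline{x},\boldsymbol{e}}\colon B_{\underline{x}}\to B_{\underline{w}}$, where $\underline{w}$ is a reduced expression of $w=\underline{x}^{\boldsymbol{e}}$, is the last term $LL_l$ of a sequence $LL_i\colon B_{(s_1,\dots,s_i)}\to B_{\underline{w}_i}$ ($\underline{w}_i$ a reduced expression of $w_i$, $\underline{w}_l=\underline{w}$), where $LL_0=\mathrm{id}_R$ and, with $s=s_i$, $\phi=LL_{i-1}\otimes\mathrm{id}_{B_s}$, and (for label $D$) $(\underline{t},s)$ a reduced expression of $w_{i-1}$: * label $U$, $\boldsymbol{e}_i=0$: $LL_i=\mathrm{rex}\circ(\mathrm{id}\otimes m^s)\circ\phi$, where $m^s(f_1\otimes f_2)=f_1f_2$; * label $U$, $\boldsymbol{e}_i=1$: $LL_i=\mathrm{rex}\circ\phi$; * label $D$, $\boldsymbol{e}_i=0$: $LL_i=\mathrm{rex}\circ(\mathrm{id}_{B_{\underline{t}}}\otimes i_0^s)\circ(\mathrm{rex}\otimes\mathrm{id}_{B_s})\circ\phi$,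 where $i_0^s(f_1\otimes f_2\otimes f_3)=f_1\partial_s(f_2)\otimes f_3$; * label $D$, $\boldsymbol{e}_i=1$: $LL_i=\mathrm{rex}\circ(\mathrm{id}_{B_{\underline{t}}}\otimes i_1^s)\circ(\mathrm{rex}\otimes\mathrm{id}_{B_s})\circ\phi$, where $i_1^s(f_1\otimes f_2\otimes f_3)=f_1\partial_s(f_2)f_3$. Fix $\delta_s\in V$ with $\langle\alpha_s^\vee,\delta_s\rangle=1$ for each $s\in S$, and let $b_{\underline{x},\boldsymbol{e}}=b_1\otimes\cdots\otimes b_l\in B_{\underline{x}}$ with $b_i=1\otimes1\in B_{s_i}$ if the label of $\boldsymbol{e}$ at $i$ is $U$, and $b_i=\delta_{s_i}\otimes1$ if it is $D$. For $w\in W$ and subexpressions $\boldsymbol{e},\boldsymbol{f}$ with $\underline{x}^{\boldsymbol{e}}=\underline{x}^{\boldsymbol{f}}=w$ write $\boldsymbol{f}<\boldsymbol{e}$ if for some $i$ the labels of $\boldsymbol{e}$ and $\boldsymbol{f}$ agree at all $j<i$, the label of $\boldsymbol{e}$ at $i$ is $D$, and the label of $\boldsymbol{f}$ at $i$ is $U$.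 **Proposition.** Let $\underline{x}$ be a word in $S$, $w\in W$, $\underline{w}$ a reduced expression of $w$, and for each $\boldsymbol{e}$ with $\underline{x}^{\boldsymbol{e}}=w$ let $LL_{\underline{x},\boldsymbol{e}}\colon B_{\underline{x}}\to B_{\underline{w}}$ be a light leaf. Then for all $\boldsymbol{e},\boldsymbol{f}$ with $\underline{x}^{\boldsymbol{e}}=\underline{x}^{\boldsymbol{f}}=w$ $$LL_{\underline{x},\boldsymbol{e}}(b_{\underline{x},\boldsymbol{f}})=\begin{cases}u_{\underline{w}}&(\boldsymbol{f}=\boldsymbol{e}),\\0&(\boldsymbol{f}<\boldsymbol{e}).\end{cases}$$ In particular, $\{LL_{\underline{x},\boldsymbol{e}}\mid\underline{x}^{\boldsymbol{e}}=w\}$ is linearly independent over $R$ in the bimodule of homomorphisms $B_{\underline{x}}\to B_{\underline{w}}$, both for the left and for the right $R$-module structure $(a\varphi b)(m)=\varphi(amb)$. -/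

import Mathlib

open scoped TensorProduct

namespace LightLeaf

/-! Words and subexpressions -/

/-- Finite sequences `(s₁, …, s_l)`, built by adding letters on the right. -/
inductive Word (S : Type*) where
  | nil : Word S
  | snoc (x : Word S) (s : S) : Word S

namespace Word

variable {S : Type*}

def length : Word S → ℕ
  | nil => 0
  | snoc x _ => x.length + 1

/-- Concatenation `(x, y)`. -/
def append (x : Word S) : Word S → Word S
  | nil => x
  | snoc y s => snoc (x.append y) s

/-- The alternating word `(s, t, s, …)` of length `m`, starting with `s`. -/
def alt (s t : S) : ℕ → Word S
  | 0 => nil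
  | m + 1 => snoc (alt s t m) (if Even m then s else t)

end Word

/-- A subexpression `e ∈ {0,1}^l` of a word of length `l`; `true` stands for `1`. -/
def Subexpr {S : Type*} : Word S → Type
  | .nil => Unit
  | .snoc x _ => Subexpr x × Bool

/-! Rings with two maps from `R`, seen as `R`-bimodules -/

section Bimodules

universe u

variable {R : Type u} [CommRing R]

/-- A commutative ring with two ring maps from `R`; it is an `R`-bimodule through
`a • m • b = left a * m * right b`. All the bimodules `R ⊗_{R^s} R ⊗_{R^t} ⋯ ⊗ R` are of this kind,
with `left` and `right` the inclusions of the first and of the last factor. -/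
structure BRing (R : Type u) [CommRing R] where
  carrier : Type u
  [ring : CommRing carrier]
  left : R →+* carrier
  right : R →+* carrier

attribute [instance] BRing.ring

namespace BRing

/-- On `X.carrier`, `R` acts from the left. -/
instance (X : BRing R) : Algebra R X.carrier := X.left.toAlgebra

/-- The same ring, on which `R` acts from the right. -/
def Rt (X : BRing R) : Type u := X.carrier

instance (X : BRing R) : CommRing X.Rt := X.ring

instance (X : BRing R) : Algebra R X.Rt := RingHom.toAlgebra (S := X.Rt) X.right

/-- `R` as an `R`-bimodule. -/
def unit (R : Type u) [CommRing R] : BRing R where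
  carrier := R
  left := RingHom.id R
  right := RingHom.id R

/-- The bimodule `X ⊗_A Y` for a subring `A` of `R`: here `A` acts on `X` from the right and on `Y`
from the left, the left action of `R` is that on `X`, the right action is that on `Y`. -/
def tensor (X : BRing R) (A : Subring R) (Y : BRing R) : BRing R where
  carrier := X.Rt ⊗[A] Y.carrier
  left := (Algebra.TensorProduct.includeLeftRingHom :
    X.Rt →+* X.Rt ⊗[A] Y.carrier).comp X.left
  right := (Algebra.TensorProduct.includeRight :
    Y.carrier →ₐ[A] X.Rt ⊗[A] Y.carrier).toRingHom.comp Y.right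

variable {X Y : BRing R} {A : Subring R}

/-- The pure tensor `a ⊗ f`. -/
def tmul (X : BRing R) (A : Subring R) (Y : BRing R) (a : X.carrier) (f : Y.carrier) :
    (X.tensor A Y).carrier :=
  TensorProduct.tmul A (M := X.Rt) (N := Y.carrier) a f

theorem tmul_mul_tmul (a b : X.carrier) (f g : Y.carrier) :
    tmul X A Y a f * tmul X A Y b g = tmul X A Y (a * b) (f * g) :=
  Algebra.TensorProduct.tmul_mul_tmul (R := A) (A := X.Rt) (B := Y.carrier) a b f g

theorem tensor_left (r : R) : (X.tensor A Y).left r = tmul X A Y (X.left r) 1 := rfl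

theorem tensor_right (r : R) : (X.tensor A Y).right r = tmul X A Y 1 (Y.right r) := rfl

theorem tensor_induction {p : (X.tensor A Y).carrier → Prop} (zero : p 0)
    (tmul : ∀ a f, p (tmul X A Y a f)) (add : ∀ m n, p m → p n → p (m + n)) (m) : p m :=
  TensorProduct.induction_on (R := A) (M := X.Rt) (N := Y.carrier) (motive := p) m zero tmul add

theorem add_tmul (a b : X.carrier) (f : Y.carrier) :
    tmul X A Y (a + b) f = tmul X A Y a f + tmul X A Y b f :=
  TensorProduct.add_tmul (R := A) (M := X.Rt) (N := Y.carrier) a b f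

theorem tmul_add (a : X.carrier) (f g : Y.carrier) :
    tmul X A Y a (f + g) = tmul X A Y a f + tmul X A Y a g :=
  TensorProduct.tmul_add (R := A) (M := X.Rt) (N := Y.carrier) a f g

theorem tmul_balanced (r : R) (hr : r ∈ A) (a : X.carrier) (f : Y.carrier) :
    tmul X A Y (X.right r * a) f = tmul X A Y a (Y.left r * f) :=
  TensorProduct.smul_tmul (R := A) (R' := A) (M := X.Rt) (N := Y.carrier) ⟨r, hr⟩ a f

/-- The additive map out of `X ⊗_A Y` given by a balanced biadditive map. -/
def lift {P : Type*} [AddCommGroup P] (φ : X.carrier → Y.carrier → P)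
    (add_left : ∀ a b f, φ (a + b) f = φ a f + φ b f)
    (add_right : ∀ a f g, φ a (f + g) = φ a f + φ a g)
    (balanced : ∀ r ∈ A, ∀ a f, φ (X.right r * a) f = φ a (Y.left r * f)) :
    (X.tensor A Y).carrier →+ P :=
  TensorProduct.liftAddHom (R := A) (M := X.Rt) (N := Y.carrier)
    (AddMonoidHom.mk' (fun a => AddMonoidHom.mk' (φ a) (add_right a))
      (fun a b => AddMonoidHom.ext (add_left a b)))
    (fun r a f => balanced r.1 r.2 a f)

theorem lift_tmul {P : Type*} [AddCommGroup P] (φ : X.carrier → Y.carrier → P) (h₁ h₂ h₃)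
    (a : X.carrier) (f : Y.carrier) :
    lift (A := A) φ h₁ h₂ h₃ (tmul X A Y a f) = φ a f := rfl

/-- The ring map `a ⊗ f ↦ φ(a) ψ(f)` out of `X ⊗_A Y`. -/
def ringLift {P : Type*} [CommRing P] (φ : X.carrier →+* P) (ψ : Y.carrier →+* P)
    (balanced : ∀ r ∈ A, φ (X.right r) = ψ (Y.left r)) : (X.tensor A Y).carrier →+* P where
  toFun := lift (A := A) (fun a f => φ a * ψ f) (fun a b f => by rw [map_add, add_mul])
    (fun a f g => by rw [map_add, mul_add])
    (fun r hr a f => by rw [map_mul, map_mul, balanced r hr, mul_comm (ψ _) (φ a), mul_assoc])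
  map_zero' := map_zero _
  map_add' := map_add _
  map_one' := by
    change lift (A := A) (fun a f => φ a * ψ f) _ _ _ (tmul X A Y 1 1) = 1
    rw [lift_tmul, map_one, map_one, one_mul]
  map_mul' m n := by
    induction m using tensor_induction with
    | zero => simp
    | add m m' h h' => rw [add_mul, map_add, h, h', map_add, add_mul]
    | tmul a f =>
      induction n using tensor_induction with
      | zero => simp
      | add m m' h h' => rw [mul_add, map_add, h, h', map_add, mul_add]
      | tmul b g => rw [tmul_mul_tmul, lift_tmul, lift_tmul, lift_tmul, map_mul, map_mul]; ring

theorem ringLift_tmul {P : Type*} [CommRing P] (φ : X.carrier →+* P) (ψ : Y.carrier →+* P) (h)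
    (a : X.carrier) (f : Y.carrier) :
    ringLift (A := A) φ ψ h (tmul X A Y a f) = φ a * ψ f := rfl

/-- `a ↦ a ⊗ 1`. -/
def incl₁ (X : BRing R) (A : Subring R) (Y : BRing R) :
    X.carrier →+* (X.tensor A Y).carrier :=
  (Algebra.TensorProduct.includeLeftRingHom : X.Rt →+* X.Rt ⊗[A] Y.carrier)

/-- `f ↦ 1 ⊗ f`. -/
def incl₂ (X : BRing R) (A : Subring R) (Y : BRing R) :
    Y.carrier →+* (X.tensor A Y).carrier :=
  (Algebra.TensorProduct.includeRight : Y.carrier →ₐ[A] X.Rt ⊗[A] Y.carrier).toRingHom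

theorem incl_balanced (r : R) (hr : r ∈ A) :
    incl₁ X A Y (X.right r) = incl₂ X A Y (Y.left r) := by
  have h := tmul_balanced (X := X) (Y := Y) r hr 1 1
  rw [mul_one, mul_one] at h
  exact h

/-- Ring maps that are compatible with the two maps from `R`. -/
def RHom (X Y : BRing R) : Type u :=
  {g : X.carrier →+* Y.carrier //
    (∀ r, g (X.left r) = Y.left r) ∧ ∀ r, g (X.right r) = Y.right r}

/-- `Z → Z ⊗_R R`. -/
def splitNil (Z : BRing R) : RHom Z (Z.tensor ⊤ (unit R)) :=
  ⟨incl₁ Z ⊤ (unit R), fun _ => rfl, fun r => incl_balanced r trivial⟩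

/-- `Z ⊗_R R → Z`. -/
def joinNil (Z : BRing R) : RHom (Z.tensor ⊤ (unit R)) Z :=
  ⟨ringLift (RingHom.id _) Z.right (fun _ _ => rfl),
    fun r => (ringLift_tmul _ _ _ (Z.left r) 1).trans
      ((congrArg (Z.left r * ·) (map_one Z.right)).trans (mul_one _)),
    fun r => (ringLift_tmul (X := Z) (Y := unit R) (A := ⊤) (RingHom.id Z.carrier) Z.right
      (fun _ _ => rfl) 1 r).trans (one_mul _)⟩

/-- From `P → Z ⊗_R X`, the map `P ⊗_A R → (Z ⊗_R X) ⊗_A R = Z ⊗_R (X ⊗_A R)`. -/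
def splitStep {Z X P : BRing R} (A : Subring R) (g : RHom P (Z.tensor ⊤ X)) :
    RHom (P.tensor A (unit R)) (Z.tensor ⊤ (X.tensor A (unit R))) :=
  ⟨ringLift
    ((ringLift (incl₁ Z ⊤ (X.tensor A (unit R)))
      ((incl₂ Z ⊤ (X.tensor A (unit R))).comp (incl₁ X A (unit R)))
      (fun r hr => by rw [RingHom.comp_apply]; exact incl_balanced r hr)).comp g.1)
    ((incl₂ Z ⊤ (X.tensor A (unit R))).comp (incl₂ X A (unit R)))
    (fun r hr => by
      rw [RingHom.comp_apply, g.2.2, tensor_right, ringLift_tmul, map_one, one_mul]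
      exact congrArg (incl₂ Z ⊤ (X.tensor A (unit R))) (incl_balanced r hr)),
  fun r => by
    rw [tensor_left, ringLift_tmul, RingHom.comp_apply, g.2.1, tensor_left, ringLift_tmul,
      map_one, map_one, mul_one, mul_one]
    rfl,
  fun r => by
    rw [tensor_right, ringLift_tmul, map_one, one_mul]
    rfl⟩

/-- From `Z ⊗_R X → P`, the map `Z ⊗_R (X ⊗_A R) = (Z ⊗_R X) ⊗_A R → P ⊗_A R`. -/
def joinStep {Z X P : BRing R} (A : Subring R) (g : RHom (Z.tensor ⊤ X) P) :
    RHom (Z.tensor ⊤ (X.tensor A (unit R))) (P.tensor A (unit R)) :=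
  ⟨ringLift ((incl₁ P A (unit R)).comp (g.1.comp (incl₁ Z ⊤ X)))
    (ringLift ((incl₁ P A (unit R)).comp (g.1.comp (incl₂ Z ⊤ X))) (incl₂ P A (unit R))
      (fun r hr => by
        rw [RingHom.comp_apply, RingHom.comp_apply]
        exact (congrArg _ (g.2.2 r)).trans (incl_balanced r hr)))
    (fun r hr => by
      rw [tensor_left, ringLift_tmul, map_one, mul_one, RingHom.comp_apply, RingHom.comp_apply,
        RingHom.comp_apply, RingHom.comp_apply, incl_balanced r hr]),
  fun r => by
    rw [tensor_left, ringLift_tmul, map_one, mul_one, RingHom.comp_apply, RingHom.comp_apply]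
    exact congrArg _ (g.2.1 r),
  fun r => by
    rw [tensor_right, ringLift_tmul, map_one, one_mul, tensor_right, ringLift_tmul, map_one,
      one_mul]
    rfl⟩

end BRing

open BRing

/-- Homomorphisms of `R`-bimodules (of all degrees), a left `R`-module with
`(a φ)(m) = φ(a m) = a φ(m)`. -/
def BHom (X Y : BRing R) : Submodule R (X.carrier →ₗ[R] Y.carrier) where
  carrier := {φ | ∀ m b, φ (m * X.right b) = φ m * Y.right b}
  add_mem' := by
    intro φ ψ hφ hψ m b
    simp [hφ m b, hψ m b, add_mul]
  zero_mem' := by intro m b; simp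
  smul_mem' := by
    intro c φ hφ m b
    simp [hφ m b]

namespace BHom

variable {X Y Z X' Y' : BRing R} {A : Subring R}

/-- Bimodule homomorphisms are the additive maps that commute with both actions. -/
def mk (φ : X.carrier →+ Y.carrier) (hl : ∀ r m, φ (X.left r * m) = Y.left r * φ m)
    (hr : ∀ m r, φ (m * X.right r) = φ m * Y.right r) : BHom X Y :=
  ⟨{ toFun := φ, map_add' := φ.map_add, map_smul' := hl }, hr⟩

theorem map_left (φ : BHom X Y) (r : R) (m : X.carrier) :
    φ.1 (X.left r * m) = Y.left r * φ.1 m := φ.1.map_smul r m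

theorem map_right (φ : BHom X Y) (r : R) (m : X.carrier) :
    φ.1 (X.right r * m) = Y.right r * φ.1 m := by
  rw [mul_comm, φ.2, mul_comm]

/-- A bimodule homomorphism as a homomorphism of right modules. -/
def rightLinear (φ : BHom X Y) : X.Rt →ₗ[R] Y.Rt where
  toFun m := φ.1 m
  map_add' := φ.1.map_add
  map_smul' r m := map_right φ r m

/-- The bimodule homomorphism out of `X ⊗_A Y` given by a balanced biadditive map. -/
def lift (φ : X.carrier → Y.carrier → Z.carrier)
    (add_left : ∀ a b f, φ (a + b) f = φ a f + φ b f)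
    (add_right : ∀ a f g, φ a (f + g) = φ a f + φ a g)
    (balanced : ∀ r ∈ A, ∀ a f, φ (X.right r * a) f = φ a (Y.left r * f))
    (left : ∀ r a f, φ (X.left r * a) f = Z.left r * φ a f)
    (right : ∀ r a f, φ a (Y.right r * f) = Z.right r * φ a f) : BHom (X.tensor A Y) Z :=
  mk (BRing.lift φ add_left add_right balanced)
    (fun r m => by
      induction m using tensor_induction with
      | zero => simp
      | add m n hm hn => rw [mul_add, map_add, hm, hn, map_add, mul_add]
      | tmul a f => rw [tensor_left, tmul_mul_tmul, lift_tmul, lift_tmul, left, one_mul])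
    (fun m r => by
      induction m using tensor_induction with
      | zero => simp
      | add m n hm hn => rw [add_mul, map_add, hm, hn, map_add, add_mul]
      | tmul a f =>
        rw [tensor_right, tmul_mul_tmul, lift_tmul, lift_tmul, mul_comm f, right, mul_one,
          mul_comm (Z.right r)])

protected def id (X : BRing R) : BHom X X := ⟨LinearMap.id, fun _ _ => rfl⟩

def comp (ψ : BHom Y Z) (φ : BHom X Y) : BHom X Z :=
  ⟨ψ.1.comp φ.1, fun m b => by
    rw [LinearMap.comp_apply, LinearMap.comp_apply, φ.2, ψ.2]⟩

/-- `φ ⊗ ψ : X ⊗_A Y → X' ⊗_A Y'`. -/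
def tensorMap (A : Subring R) (φ : BHom X X') (ψ : BHom Y Y') :
    BHom (X.tensor A Y) (X'.tensor A Y') :=
  lift (fun a f => tmul X' A Y' (φ.1 a) (ψ.1 f))
    (fun a b f => by rw [map_add, add_tmul])
    (fun a f g => by rw [map_add, tmul_add])
    (fun r hr a f => by rw [map_right, tmul_balanced r hr, map_left])
    (fun r a f => by rw [map_left, tensor_left, tmul_mul_tmul, one_mul])
    (fun r a f => by rw [map_right, tensor_right, tmul_mul_tmul, one_mul])

/-- `X ⊗_A R → X`, `a ⊗ f ↦ a f`; this is `id_X ⊗ m^s` when `A = R^s`. -/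
def mulRight (X : BRing R) (A : Subring R) : BHom (X.tensor A (unit R)) X :=
  lift (fun a f => a * X.right f)
    (fun a b f => add_mul _ _ _)
    (fun a f g => by erw [map_add, mul_add])
    (fun r _ a f => by erw [map_mul]; rw [mul_comm (X.right r), mul_assoc]; rfl)
    (fun r a f => mul_assoc _ _ _)
    (fun r a f => by erw [map_mul]; exact mul_left_comm _ _ _)

/-- The map `X ⊗_A R → X`, `a ⊗ f ↦ a D(f)`, for `D : R → R` that is linear over `A`. -/
def contract (X : BRing R) (A : Subring R) (D : R →ₗ[A] R) :
    (X.tensor A (unit R)).carrier →+ X.carrier :=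
  BRing.lift (fun a f => a * X.right (D f))
    (fun a b f => add_mul _ _ _)
    (fun a f g => by erw [map_add, map_add, mul_add])
    (fun r hr a f => by
      erw [D.map_smul ⟨r, hr⟩ f, map_mul]
      rw [mul_comm (X.right r), mul_assoc])

theorem contract_left (D : R →ₗ[A] R) (r : R) (m : (X.tensor A (unit R)).carrier) :
    contract X A D ((X.tensor A (unit R)).left r * m) = X.left r * contract X A D m := by
  induction m using tensor_induction with
  | zero => simp
  | add m n hm hn => rw [mul_add, map_add, hm, hn, map_add, mul_add]
  | tmul a f =>
    rw [tensor_left, tmul_mul_tmul, one_mul]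
    exact mul_assoc _ _ _

theorem contract_right (D : R →ₗ[A] R) (r : R) (hr : r ∈ A)
    (m : (X.tensor A (unit R)).carrier) :
    contract X A D ((X.tensor A (unit R)).right r * m) = X.right r * contract X A D m := by
  induction m using tensor_induction with
  | zero => simp
  | add m n hm hn => rw [mul_add, map_add, hm, hn, map_add, mul_add]
  | tmul a f =>
    rw [tensor_right, tmul_mul_tmul, one_mul]
    refine (congrArg (fun g => a * X.right g) (D.map_smul ⟨r, hr⟩ f)).trans ?_
    refine (congrArg (a * ·) (map_mul X.right r (D f))).trans ?_
    exact mul_left_comm _ _ _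

/-- `X ⊗_A R ⊗_A R → X ⊗_A R`, `a ⊗ f ⊗ g ↦ a D(f) ⊗ g`. -/
def contractMid (X : BRing R) (A : Subring R) (D : R →ₗ[A] R) :
    BHom ((X.tensor A (unit R)).tensor A (unit R)) (X.tensor A (unit R)) :=
  lift (fun m g => tmul X A (unit R) (contract X A D m) g)
    (fun a b f => by rw [map_add, add_tmul])
    (fun a f g => tmul_add _ _ _)
    (fun r hr a f => by rw [contract_right D r hr, tmul_balanced r hr])
    (fun r a f => by rw [contract_left, tensor_left, tmul_mul_tmul, one_mul])
    (fun r a f => by rw [tensor_right, tmul_mul_tmul, one_mul])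

/-- A ring map that is compatible with both maps from `R`, as a bimodule homomorphism. -/
def ofRingHom (g : RHom X Y) : BHom X Y :=
  mk g.1.toAddMonoidHom (fun r m => (map_mul g.1 _ _).trans (by rw [g.2.1]; rfl))
    (fun m r => (map_mul g.1 _ _).trans (by rw [g.2.2]; rfl))

end BHom

end Bimodules

/-! The representation and the polynomial ring -/

section Realization

universe u v

open BRing

variable {k : Type u} [CommRing k] {W : Type*} [Group W] {S : Type*} {M : CoxeterMatrix S}

/-- A `k`-linear representation `V` of the Coxeter group `W` with elements `α_s ∈ V` and
`α_s^∨ ∈ V^*` such that each `s` acts by the reflection `v ↦ v - ⟨α_s^∨, v⟩ α_s`. -/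
structure Realization (k : Type u) [CommRing k] (cs : CoxeterSystem M W) (V : Type v)
    [AddCommGroup V] [Module k V] where
  rep : Representation k W V
  root : S → V
  coroot : S → Module.Dual k V
  coroot_root : ∀ s, coroot s (root s) = 2
  rep_simple : ∀ s v, rep (cs.simple s) v = v - coroot s v • root s
  coroot_surjective : ∀ s, Function.Surjective (coroot s)
  root_ne_zero : ∀ s, root s ≠ 0

variable {cs : CoxeterSystem M W} {V : Type v} [AddCommGroup V] [Module k V]

namespace Realization

/-- The element of `R = S(V)` given by an element of `V`. -/
abbrev vec (k : Type u) [CommRing k] {V : Type v} [AddCommGroup V] [Module k V] (v : V) :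
    SymmetricAlgebra k V := SymmetricAlgebra.ι k V v

/-- The action of `W` on `R = S(V)` by algebra maps. -/
noncomputable def act (ℛ : Realization k cs V) (w : W) :
    SymmetricAlgebra k V →ₐ[k] SymmetricAlgebra k V :=
  SymmetricAlgebra.lift (SymmetricAlgebra.ι k V ∘ₗ ℛ.rep w)

/-- The ring of invariants `R^s`. -/
noncomputable def fixed (ℛ : Realization k cs V) (s : S) : Subring (SymmetricAlgebra k V) :=
  (ℛ.act (cs.simple s)).toRingHom.eqLocus (RingHom.id _)

theorem vec_injective : Function.Injective (vec k (V := V)) := by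
  let _ : Module kᵐᵒᵖ V := Module.compHom _ ((RingHom.id k).fromOpposite mul_comm)
  have : IsCentralScalar k V := ⟨fun r m => rfl⟩
  intro a b h
  have h' := congrArg (SymmetricAlgebra.lift (TrivSqZeroExt.inrHom k V)) h
  rw [vec, vec, SymmetricAlgebra.lift_ι_apply, SymmetricAlgebra.lift_ι_apply] at h'
  exact TrivSqZeroExt.inr_injective h'

theorem exists_demazure (ℛ : Realization k cs V) (s : S) (f : SymmetricAlgebra k V) :
    ∃ g, vec k (ℛ.root s) * g = f - ℛ.act (cs.simple s) f := by
  induction f using SymmetricAlgebra.induction with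
  | algebraMap r => exact ⟨0, by simp⟩
  | ι x =>
    refine ⟨algebraMap k _ (ℛ.coroot s x), ?_⟩
    rw [act, SymmetricAlgebra.lift_ι_apply, LinearMap.comp_apply, ℛ.rep_simple, map_sub,
      sub_sub_cancel, map_smul, Algebra.smul_def, mul_comm]
  | mul a b ha hb =>
    obtain ⟨g, hg⟩ := ha
    obtain ⟨h, hh⟩ := hb
    refine ⟨g * b + ℛ.act (cs.simple s) a * h, ?_⟩
    rw [map_mul]
    linear_combination b * hg + ℛ.act (cs.simple s) a * hh
  | add a b ha hb =>
    obtain ⟨g, hg⟩ := ha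
    obtain ⟨h, hh⟩ := hb
    refine ⟨g + h, ?_⟩
    rw [map_add]
    linear_combination hg + hh

section Domain

variable [IsDomain k] [Module.Free k V]

theorem vec_root_cancel (ℛ : Realization k cs V) (s : S) {f g : SymmetricAlgebra k V}
    (h : vec k (ℛ.root s) * f = vec k (ℛ.root s) * g) : f = g := by
  refine mul_left_cancel₀ (fun h0 => ℛ.root_ne_zero s (vec_injective (k := k) ?_)) h
  rw [h0, vec, map_zero]

/-- `∂_s(f) = (f - s(f)) / α_s`: the unique element whose product with `α_s` is `f - s(f)`. -/
noncomputable def demazure (ℛ : Realization k cs V) (s : S) :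
    SymmetricAlgebra k V →ₗ[ℛ.fixed s] SymmetricAlgebra k V where
  toFun f := (ℛ.exists_demazure s f).choose
  map_add' f g := by
    apply ℛ.vec_root_cancel s
    rw [mul_add, (ℛ.exists_demazure s _).choose_spec, (ℛ.exists_demazure s _).choose_spec,
      (ℛ.exists_demazure s _).choose_spec, map_add]
    ring
  map_smul' r f := by
    apply ℛ.vec_root_cancel s
    have hr : ℛ.act (cs.simple s) r.1 = r.1 := r.2
    have h : ∀ g, r • g = r.1 * g := fun g => rfl
    rw [RingHom.id_apply, h, h, mul_left_comm, (ℛ.exists_demazure s _).choose_spec,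
      (ℛ.exists_demazure s _).choose_spec, map_mul, hr, mul_sub]

theorem root_mul_demazure (ℛ : Realization k cs V) (s : S) (f : SymmetricAlgebra k V) :
    vec k (ℛ.root s) * ℛ.demazure s f = f - ℛ.act (cs.simple s) f :=
  (ℛ.exists_demazure s f).choose_spec

end Domain

/-! Bott-Samelson bimodules -/

/-- `B_x = B_{s₁} ⊗_R ⋯ ⊗_R B_{s_l} = R ⊗_{R^{s₁}} R ⊗_{R^{s₂}} ⋯ ⊗_{R^{s_l}} R`. -/
noncomputable def B (ℛ : Realization k cs V) : Word S → BRing (SymmetricAlgebra k V)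
  | .nil => unit _
  | .snoc x s => (ℛ.B x).tensor (ℛ.fixed s) (unit _)

/-- `a ⊗ (1 ⊗ f) = a ⊗ f` in `B_x ⊗_R B_s = B_x ⊗_{R^s} R`. -/
noncomputable def snocTmul (ℛ : Realization k cs V) (x : Word S) (s : S) (a : (ℛ.B x).carrier)
    (f : SymmetricAlgebra k V) : (ℛ.B (x.snoc s)).carrier :=
  tmul (ℛ.B x) (ℛ.fixed s) (unit _) a f

/-- `u_x = (1 ⊗ 1) ⊗ ⋯ ⊗ (1 ⊗ 1)`. -/
noncomputable def uElt (ℛ : Realization k cs V) : (x : Word S) → (ℛ.B x).carrier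
  | .nil => (1 : SymmetricAlgebra k V)
  | .snoc x s => ℛ.snocTmul x s (ℛ.uElt x) 1

/-- Pure tensors of degree `d` in `B_x`. Elements of `V` have degree `2`, and `1 ⊗ 1 ∈ B_s` has
degree `-1`. -/
inductive IsHomogPure (ℛ : Realization k cs V) : (x : Word S) → ℤ → (ℛ.B x).carrier → Prop
  | nil (n : ℕ) (f : SymmetricAlgebra k V)
      (hf : f ∈ LinearMap.range (SymmetricAlgebra.ι k V) ^ n) : IsHomogPure ℛ .nil (2 * n) f
  | snoc {x : Word S} (s : S) {d : ℤ} {a : (ℛ.B x).carrier} (ha : IsHomogPure ℛ x d a)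
      (n : ℕ) (f : SymmetricAlgebra k V)
      (hf : f ∈ LinearMap.range (SymmetricAlgebra.ι k V) ^ n) :
      IsHomogPure ℛ (x.snoc s) (d + (2 * n - 1)) (ℛ.snocTmul x s a f)

/-- The degree `d` part of `B_x`. -/
noncomputable def gradedPart (ℛ : Realization k cs V) (x : Word S) (d : ℤ) :
    AddSubgroup (ℛ.B x).carrier :=
  AddSubgroup.closure {m | ℛ.IsHomogPure x d m}

/-- Generators of the summands `(B_x)_Q^w` over `Q`, coming from
`(B_s)_Q^e = Q (δ ⊗ 1 - 1 ⊗ s(δ))` and `(B_s)_Q^s = Q (δ ⊗ 1 - 1 ⊗ δ)` for `⟨α_s^∨, δ⟩ = 1`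
(these two elements do not depend on `δ`), and
`(X ⊗ B_s)_Q^w = X_Q^w ⊗ (B_s)_Q^e ⊕ X_Q^{ws} ⊗ (B_s)_Q^s`. -/
inductive IsStalkGen (ℛ : Realization k cs V) : (x : Word S) → W → (ℛ.B x).carrier → Prop
  | nil : IsStalkGen ℛ .nil 1 (1 : SymmetricAlgebra k V)
  | snoc_one {x : Word S} {w : W} {a : (ℛ.B x).carrier} (s : S) (δ : V)
      (hδ : ℛ.coroot s δ = 1) (ha : IsStalkGen ℛ x w a) :
      IsStalkGen ℛ (x.snoc s) w
        (ℛ.snocTmul x s (a * (ℛ.B x).right (vec k δ)) 1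
          - ℛ.snocTmul x s a (ℛ.act (cs.simple s) (vec k δ)))
  | snoc_simple {x : Word S} {w : W} {a : (ℛ.B x).carrier} (s : S) (δ : V)
      (hδ : ℛ.coroot s δ = 1) (ha : IsStalkGen ℛ x w a) :
      IsStalkGen ℛ (x.snoc s) (w * cs.simple s)
        (ℛ.snocTmul x s (a * (ℛ.B x).right (vec k δ)) 1
          - ℛ.snocTmul x s a (vec k δ))

/-- The summand `(B_x)_Q^w` of `B_x ⊗_R Q`, formed with the right action of `R = S(V)` on `B_x`,
where `Q` is the fraction field of `R`. -/
noncomputable def stalk (ℛ : Realization k cs V) (x : Word S) (w : W) :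
    Submodule (FractionRing (SymmetricAlgebra k V))
      (FractionRing (SymmetricAlgebra k V) ⊗[SymmetricAlgebra k V] (ℛ.B x).Rt) :=
  Submodule.span _ {m | ∃ a : (ℛ.B x).carrier, ℛ.IsStalkGen x w a ∧
    m = TensorProduct.tmul (SymmetricAlgebra k V) (N := (ℛ.B x).Rt) 1 a}

/-- `φ : B_x → B_y` is a morphism of the category `𝒞`: it has degree zero, and `φ ⊗ Q` maps
`(B_x)_Q^w` to `(B_y)_Q^w` for every `w`. -/
structure IsMorphism (ℛ : Realization k cs V) {x y : Word S} (φ : BHom (ℛ.B x) (ℛ.B y)) :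
    Prop where
  degree_zero : ∀ d, ∀ m ∈ ℛ.gradedPart x d, φ.1 m ∈ ℛ.gradedPart y d
  stalk_le : ∀ w, ∀ m ∈ ℛ.stalk x w,
    LinearMap.baseChange (FractionRing (SymmetricAlgebra k V)) (BHom.rightLinear φ) m ∈ ℛ.stalk y w

/-- The maps of the two-colour assumption for `s, t`: morphisms `B_{(s,t,…)} → B_{(t,s,…)}` of `𝒞`
with `u ↦ u`, where both words have length `m_{st}`. -/
structure BraidMorphism (ℛ : Realization k cs V) (s t : S) where
  hom : BHom (ℛ.B (Word.alt s t (M s t))) (ℛ.B (Word.alt t s (M s t)))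
  isMorphism : ℛ.IsMorphism hom
  map_u : hom.1 (ℛ.uElt _) = ℛ.uElt _

/-- A choice, for all `s ≠ t` such that `st` has finite order `m_{st}` (for infinite order
`M s t = 0`), of a morphism `B_{(s,t,…)} → B_{(t,s,…)}` as in the two-colour assumption. -/
abbrev BraidMorphisms (ℛ : Realization k cs V) :=
  ∀ s t : S, s ≠ t → M s t ≠ 0 → ℛ.BraidMorphism s t

/-- `φ ⊗ id : B_{(x, v)} → B_{(y, v)}` for `φ : B_x → B_y`. -/
noncomputable def tensorWord (ℛ : Realization k cs V) {x y : Word S}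
    (φ : BHom (ℛ.B x) (ℛ.B y)) : (v : Word S) → BHom (ℛ.B (x.append v)) (ℛ.B (y.append v))
  | .nil => φ
  | .snoc v s => BHom.tensorMap (ℛ.fixed s) (ℛ.tensorWord φ v) (BHom.id (unit _))

/-- `φ ⊗ id : B_{(x, s)} → B_{(y, s)}` for `φ : B_x → B_y`. -/
noncomputable def tensorLetter (ℛ : Realization k cs V) {x y : Word S}
    (φ : BHom (ℛ.B x) (ℛ.B y)) (s : S) : BHom (ℛ.B (x.snoc s)) (ℛ.B (y.snoc s)) :=
  BHom.tensorMap (ℛ.fixed s) φ (BHom.id (unit _))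

/-- The identification `B_{(z, x)} = B_z ⊗_R B_x`, from left to right. -/
noncomputable def split (ℛ : Realization k cs V) (z : Word S) :
    (x : Word S) → RHom (ℛ.B (z.append x)) ((ℛ.B z).tensor ⊤ (ℛ.B x))
  | .nil => splitNil (ℛ.B z)
  | .snoc x s => splitStep (ℛ.fixed s) (ℛ.split z x)

/-- The identification `B_{(z, x)} = B_z ⊗_R B_x`, from right to left. -/
noncomputable def join (ℛ : Realization k cs V) (z : Word S) :
    (x : Word S) → RHom ((ℛ.B z).tensor ⊤ (ℛ.B x)) (ℛ.B (z.append x))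
  | .nil => joinNil (ℛ.B z)
  | .snoc x s => joinStep (ℛ.fixed s) (ℛ.join z x)

/-- `id ⊗ φ : B_{(z, x)} → B_{(z, y)}` for `φ : B_x → B_y`. -/
noncomputable def wordTensor (ℛ : Realization k cs V) (z : Word S) {x y : Word S}
    (φ : BHom (ℛ.B x) (ℛ.B y)) : BHom (ℛ.B (z.append x)) (ℛ.B (z.append y)) :=
  BHom.comp (BHom.ofRingHom (ℛ.join z y))
    (BHom.comp (BHom.tensorMap ⊤ (BHom.id (ℛ.B z)) φ) (BHom.ofRingHom (ℛ.split z x)))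

/-- `id ⊗ m^s : B_{(x, s)} → B_x`, where `m^s(f₁ ⊗ f₂) = f₁ f₂`. -/
noncomputable def idM (ℛ : Realization k cs V) (x : Word S) (s : S) :
    BHom (ℛ.B (x.snoc s)) (ℛ.B x) :=
  BHom.mulRight (ℛ.B x) (ℛ.fixed s)

theorem idM_apply (ℛ : Realization k cs V) (x : Word S) (s : S) (a : (ℛ.B x).carrier)
    (f : SymmetricAlgebra k V) :
    (ℛ.idM x s).1 (ℛ.snocTmul x s a f) = a * (ℛ.B x).right f := rfl

section Domain

variable [IsDomain k] [Module.Free k V]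

/-- `id ⊗ i_0^s : B_{(x, s, s)} → B_{(x, s)}`, where `i_0^s(f₁ ⊗ f₂ ⊗ f₃) = f₁ ∂_s(f₂) ⊗ f₃`. -/
noncomputable def idI₀ (ℛ : Realization k cs V) (x : Word S) (s : S) :
    BHom (ℛ.B ((x.snoc s).snoc s)) (ℛ.B (x.snoc s)) :=
  BHom.contractMid (ℛ.B x) (ℛ.fixed s) (ℛ.demazure s)

/-- `id ⊗ i_1^s : B_{(x, s, s)} → B_x`, where `i_1^s(f₁ ⊗ f₂ ⊗ f₃) = f₁ ∂_s(f₂) f₃`. -/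
noncomputable def idI₁ (ℛ : Realization k cs V) (x : Word S) (s : S) :
    BHom (ℛ.B ((x.snoc s).snoc s)) (ℛ.B x) :=
  BHom.comp (ℛ.idM x s) (ℛ.idI₀ x s)

theorem idI₀_apply (ℛ : Realization k cs V) (x : Word S) (s : S) (a : (ℛ.B x).carrier)
    (f g : SymmetricAlgebra k V) :
    (ℛ.idI₀ x s).1 (ℛ.snocTmul _ s (ℛ.snocTmul x s a f) g)
      = ℛ.snocTmul x s (a * (ℛ.B x).right (ℛ.demazure s f)) g := rfl

theorem idI₁_apply (ℛ : Realization k cs V) (x : Word S) (s : S) (a : (ℛ.B x).carrier)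
    (f g : SymmetricAlgebra k V) :
    (ℛ.idI₁ x s).1 (ℛ.snocTmul _ s (ℛ.snocTmul x s a f) g)
      = a * (ℛ.B x).right (ℛ.demazure s f) * (ℛ.B x).right g := rfl

end Domain

/-- `IsRex β x y φ`: there is a sequence of words from `x` to `y` in which neighbours differ by a
single braid relation `(z, (s,t,…), v) → (z, (t,s,…), v)`, and `φ : B_x → B_y` is the composite of
the maps `id ⊗ β_{s,t} ⊗ id` along it. -/
inductive IsRex (ℛ : Realization k cs V) (β : ℛ.BraidMorphisms) (x : Word S) :
    (y : Word S) → BHom (ℛ.B x) (ℛ.B y) → Prop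
  | refl : IsRex ℛ β x x (BHom.id _)
  | step (z v : Word S) (s t : S) (hst : s ≠ t) (hM : M s t ≠ 0)
      {φ : BHom (ℛ.B x) (ℛ.B ((z.append (Word.alt s t (M s t))).append v))}
      (hφ : IsRex ℛ β x _ φ) :
      IsRex ℛ β x ((z.append (Word.alt t s (M s t))).append v)
        (BHom.comp (ℛ.tensorWord (ℛ.wordTensor z (β s t hst hM).hom) v) φ)

end Realization

end Realization

/-! Subexpressions and light leaves -/

section LightLeaves

universe u v

variable {W : Type*} [Group W] {S : Type*} {M : CoxeterMatrix S}

/-- The product `s₁ ⋯ s_l` of a word. -/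
def Word.prod (cs : CoxeterSystem M W) : Word S → W
  | .nil => 1
  | .snoc x s => Word.prod cs x * cs.simple s

/-- `x` is a reduced expression of `w`. -/
def IsReducedExpr (cs : CoxeterSystem M W) (x : Word S) (w : W) : Prop :=
  x.prod cs = w ∧ x.length = cs.length w

/-- `x^e = s₁^{e₁} ⋯ s_l^{e_l}`. -/
def Subexpr.eval (cs : CoxeterSystem M W) : {x : Word S} → Subexpr x → W
  | .nil, _ => 1
  | .snoc _ s, e => Subexpr.eval cs e.1 * (if e.2 then cs.simple s else 1)

inductive Label where
  | U
  | D

open Classical in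
/-- The label at the index `i` if `w = x_{i-1}` and `s = s_i`: it is `U` if `w s > w` and `D`
otherwise. -/
noncomputable def label (cs : CoxeterSystem M W) (w : W) (s : S) : Label :=
  if cs.length w < cs.length (w * cs.simple s) then .U else .D

/-- The labels of `e` at the indices `1, …, l`. -/
noncomputable def Subexpr.labels (cs : CoxeterSystem M W) : {x : Word S} → Subexpr x → List Label
  | .nil, _ => []
  | .snoc _ s, e => Subexpr.labels cs e.1 ++ [label cs (Subexpr.eval cs e.1) s]

/-- `f < e`: the labels of `e` and `f` agree before some index `i`, at which the label of `e`
is `D` and that of `f` is `U`. -/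
def Subexpr.Lt (cs : CoxeterSystem M W) {x : Word S} (f e : Subexpr x) : Prop :=
  ∃ i : ℕ, (∀ j < i, (e.labels cs)[j]? = (f.labels cs)[j]?) ∧
    (e.labels cs)[i]? = some .D ∧ (f.labels cs)[i]? = some .U

variable {k : Type u} [CommRing k] {cs : CoxeterSystem M W} {V : Type v} [AddCommGroup V]
  [Module k V]

namespace Realization

/-- `b_{x,e} = b₁ ⊗ ⋯ ⊗ b_l` where `b_i = 1 ⊗ 1` if the label of `e` at `i` is `U`, and
`b_i = δ_{s_i} ⊗ 1` if it is `D`. -/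
noncomputable def bElt (ℛ : Realization k cs V) (δ : S → V) :
    {x : Word S} → Subexpr x → (ℛ.B x).carrier
  | .nil, _ => (1 : SymmetricAlgebra k V)
  | .snoc x s, e =>
    match label cs (Subexpr.eval cs e.1) s with
    | .U => ℛ.snocTmul x s (ℛ.bElt δ e.1) 1
    | .D => ℛ.snocTmul x s (ℛ.bElt δ e.1 * (ℛ.B x).right (vec k (δ s))) 1

variable [IsDomain k] [Module.Free k V]

/-- `IsLightLeaf β e y φ`: for the subexpression `e` of `x` and the reduced expression `y` of
`x^e`, the map `φ : B_x → B_y` is a light leaf, obtained with some choice of the reduced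
expressions and of the maps `rex` in the construction. In each step `φ` is the light leaf of
the first letters and `ρ`, `ρ'` are maps `rex`. -/
inductive IsLightLeaf (ℛ : Realization k cs V) (β : ℛ.BraidMorphisms) :
    {x : Word S} → Subexpr x → (y : Word S) → BHom (ℛ.B x) (ℛ.B y) → Prop
  | nil : IsLightLeaf ℛ β (x := .nil) () .nil (BHom.id _)
  | U0 {x : Word S} {e : Subexpr x} {y : Word S} {φ : BHom (ℛ.B x) (ℛ.B y)} (s : S)
      (hφ : IsLightLeaf ℛ β e y φ) (hU : label cs (e.eval cs) s = .U)
      {y' : Word S} (hy' : IsReducedExpr cs y' (e.eval cs))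
      {ρ : BHom (ℛ.B y) (ℛ.B y')} (hρ : ℛ.IsRex β y y' ρ) :
      IsLightLeaf ℛ β (x := x.snoc s) (e, false) y'
        (BHom.comp ρ (BHom.comp (ℛ.idM y s) (ℛ.tensorLetter φ s)))
  | U1 {x : Word S} {e : Subexpr x} {y : Word S} {φ : BHom (ℛ.B x) (ℛ.B y)} (s : S)
      (hφ : IsLightLeaf ℛ β e y φ) (hU : label cs (e.eval cs) s = .U)
      {y' : Word S} (hy' : IsReducedExpr cs y' (e.eval cs * cs.simple s))
      {ρ : BHom (ℛ.B (y.snoc s)) (ℛ.B y')} (hρ : ℛ.IsRex β (y.snoc s) y' ρ) :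
      IsLightLeaf ℛ β (x := x.snoc s) (e, true) y' (BHom.comp ρ (ℛ.tensorLetter φ s))
  | D0 {x : Word S} {e : Subexpr x} {y : Word S} {φ : BHom (ℛ.B x) (ℛ.B y)} (s : S)
      (hφ : IsLightLeaf ℛ β e y φ) (hD : label cs (e.eval cs) s = .D)
      {t : Word S} (ht : IsReducedExpr cs (t.snoc s) (e.eval cs))
      {ρ : BHom (ℛ.B y) (ℛ.B (t.snoc s))} (hρ : ℛ.IsRex β y (t.snoc s) ρ)
      {y' : Word S} (hy' : IsReducedExpr cs y' (e.eval cs))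
      {ρ' : BHom (ℛ.B (t.snoc s)) (ℛ.B y')} (hρ' : ℛ.IsRex β (t.snoc s) y' ρ') :
      IsLightLeaf ℛ β (x := x.snoc s) (e, false) y'
        (BHom.comp ρ' (BHom.comp (ℛ.idI₀ t s)
          (BHom.comp (ℛ.tensorLetter ρ s) (ℛ.tensorLetter φ s))))
  | D1 {x : Word S} {e : Subexpr x} {y : Word S} {φ : BHom (ℛ.B x) (ℛ.B y)} (s : S)
      (hφ : IsLightLeaf ℛ β e y φ) (hD : label cs (e.eval cs) s = .D)
      {t : Word S} (ht : IsReducedExpr cs (t.snoc s) (e.eval cs))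
      {ρ : BHom (ℛ.B y) (ℛ.B (t.snoc s))} (hρ : ℛ.IsRex β y (t.snoc s) ρ)
      {y' : Word S} (hy' : IsReducedExpr cs y' (e.eval cs * cs.simple s))
      {ρ' : BHom (ℛ.B t) (ℛ.B y')} (hρ' : ℛ.IsRex β t y' ρ') :
      IsLightLeaf ℛ β (x := x.snoc s) (e, true) y'
        (BHom.comp ρ' (BHom.comp (ℛ.idI₁ t s)
          (BHom.comp (ℛ.tensorLetter ρ s) (ℛ.tensorLetter φ s))))

end Realization

end LightLeaves

end LightLeaf

namespace LightLeaf

section Support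

universe u v

open BRing

/-! Values of bimodule maps on pure tensors -/

section Bimodules

variable {R : Type u} [CommRing R] {X Y X' Y' : BRing R} {A : Subring R}

/-! The elements $b_{\underline{x},\boldsymbol{f}}$ are test vectors against which the matrix
$LL_{\underline{x},\boldsymbol{e}}(b_{\underline{x},\boldsymbol{f}})$ is unitriangular.

Every $B_{\underline{x}}$ is a commutative ring with unit $u_{\underline{x}}$, and every rex map
preserves the unit because the braid morphisms do (`IsRex.map_one`). Hence a light leaf can be
evaluated on a test vector letter by letter. At label $U$ the value $1$ of the shorter leaf becomes
$1\otimes1$, which the identity and $m^s$ send to $1$. At label $D$ the letter $\delta_s\otimes1$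
leads to $1\otimes\delta_s\otimes1$, which $i_0^s$ and $i_1^s$ send to $1$ because
$\partial_s(\delta_s)=1$. This is the diagonal (`IsLightLeaf.map_bElt`). If
$\boldsymbol{f}<\boldsymbol{e}$, then before the first difference the two test vectors coincide, and
at the difference the map for $D$ meets $1\otimes1\otimes1$, which dies because $\partial_s(1)=0$.
Later letters act through bimodule maps and cannot revive a zero (`IsLightLeaf.map_bElt_of_lt`).

Two subexpressions of $\underline{x}$ with the same product are equal once their labels are
(`Subexpr.eq_of_labels_eq`), so $<$ is a strict total order on the index set. Since $R$ acts
faithfully on $u_{\underline{w}}$ from either side, evaluating a linear relation at the test vector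
of the smallest index in its support gives a contradiction. -/

theorem BRing.tmul_one_one : tmul X A Y 1 1 = 1 := rfl

theorem BRing.zero_tmul (f : Y.carrier) : tmul X A Y 0 f = 0 :=
  TensorProduct.zero_tmul (R := A) X.Rt f

theorem BHom.tensorMap_tmul (φ : BHom X X') (ψ : BHom Y Y') (a : X.carrier) (f : Y.carrier) :
    (BHom.tensorMap A φ ψ).1 (tmul X A Y a f) = tmul X' A Y' (φ.1 a) (ψ.1 f) := rfl

theorem BHom.comp_apply {Z : BRing R} (ψ : BHom Y Z) (φ : BHom X Y) (m : X.carrier) :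
    (BHom.comp ψ φ).1 m = ψ.1 (φ.1 m) := rfl

theorem BHom.tensorMap_one (φ : BHom X X') (ψ : BHom Y Y') (hφ : φ.1 1 = 1) (hψ : ψ.1 1 = 1) :
    (BHom.tensorMap A φ ψ).1 1 = 1 := by
  rw [← tmul_one_one, tensorMap_tmul, hφ, hψ, tmul_one_one]

theorem BHom.ofRingHom_one (g : RHom X Y) : (BHom.ofRingHom g).1 1 = 1 := map_one g.1

theorem BHom.map_mul_right (φ : BHom X Y) (m : X.carrier) (r : R) :
    φ.1 (m * X.right r) = φ.1 m * Y.right r := φ.2 m r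

/-- Applied to rex maps, this carries $\delta_s$ unchanged to the place where $\partial_s$ acts. -/
theorem BHom.map_right_of_map_one (φ : BHom X Y) (h : φ.1 1 = 1) (r : R) :
    φ.1 (X.right r) = Y.right r := by
  rw [← one_mul (X.right r), map_mul_right, h, one_mul]

theorem BHom.id_apply (m : X.carrier) : (BHom.id X).1 m = m := rfl

end Bimodules

variable {k : Type u} [CommRing k] {W : Type*} [Group W] {S : Type*} {M : CoxeterMatrix S}
  {cs : CoxeterSystem M W} {V : Type v} [AddCommGroup V] [Module k V]

/-! Labels determine subexpressions of a given element -/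

namespace Subexpr

variable (cs) in
theorem labels_snoc {x : Word S} {s : S} (e : Subexpr (x.snoc s)) :
    labels cs e = labels cs (x := x) e.1 ++ [label cs (eval cs (x := x) e.1) s] := rfl

theorem length_labels : {x : Word S} → (e : Subexpr x) → (labels cs e).length = x.length
  | .nil, _ => rfl
  | .snoc x s, e => by
    rw [labels_snoc, List.length_append, length_labels (x := x) e.1]
    rfl

theorem labels_snoc_eq_iff {x : Word S} {s : S} {e f : Subexpr (x.snoc s)} :
    labels cs e = labels cs f ↔ labels cs (x := x) e.1 = labels cs (x := x) f.1 ∧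
      label cs (eval cs (x := x) e.1) s = label cs (eval cs (x := x) f.1) s := by
  rw [labels_snoc, labels_snoc]
  refine ⟨fun h => ?_, fun h => by rw [h.1, h.2]⟩
  obtain ⟨h₁, h₂⟩ := List.append_inj' h rfl
  exact ⟨h₁, List.singleton_inj.mp h₂⟩

/-- The lexicographic description of `f < e`. -/
theorem lt_snoc {x : Word S} {s : S} {e f : Subexpr (x.snoc s)} (h : Lt cs f e) :
    Lt cs (x := x) f.1 e.1 ∨ (labels cs (x := x) e.1 = labels cs (x := x) f.1 ∧
      label cs (eval cs (x := x) e.1) s = .D ∧ label cs (eval cs (x := x) f.1) s = .U) := by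
  obtain ⟨i, hlt, he, hf⟩ := h
  have hle := length_labels (cs := cs) (x := x) e.1
  have hlf := length_labels (cs := cs) (x := x) f.1
  rw [labels_snoc] at he hf
  simp only [labels_snoc] at hlt
  -- The label list has an entry at `i`, so `i` is at most the index of the last letter.
  have hi : i < x.length + 1 := by
    by_contra! hi
    rw [List.getElem?_eq_none (by simp [hle]; exact hi)] at he
    exact nomatch he
  have restrict : ∀ j < x.length, (labels cs e.1 ++ [label cs (eval cs e.1) s])[j]?
        = (labels cs (x := x) e.1)[j]? ∧
      (labels cs f.1 ++ [label cs (eval cs f.1) s])[j]? = (labels cs (x := x) f.1)[j]? :=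
    fun j hj => ⟨List.getElem?_append_left (hle ▸ hj), List.getElem?_append_left (hlf ▸ hj)⟩
  -- The first difference lies either inside `x` or exactly at the last letter.
  rcases Nat.lt_succ_iff_lt_or_eq.mp hi with hi | rfl
  · left
    refine ⟨i, fun j hj => ?_, (restrict i hi).1 ▸ he, (restrict i hi).2 ▸ hf⟩
    rw [← (restrict j (hj.trans hi)).1, ← (restrict j (hj.trans hi)).2, hlt j hj]
  · right
    refine ⟨List.ext_getElem? fun j => ?_, ?_, ?_⟩
    · by_cases hj : j < x.length
      · rw [← (restrict j hj).1, ← (restrict j hj).2, hlt j hj]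
      · rw [List.getElem?_eq_none (by omega), List.getElem?_eq_none (by omega)]
    · rw [← hle, List.getElem?_concat_length] at he
      exact Option.some.inj he
    · rw [← hlf, List.getElem?_concat_length] at hf
      exact Option.some.inj hf

theorem lt_irrefl {x : Word S} (e : Subexpr x) : ¬ Lt cs e e := by
  rintro ⟨i, -, hD, hU⟩
  rw [hD] at hU
  exact nomatch hU

/-- The smaller of the two distinguishing indices works. They cannot coincide, since the middle list
would then carry both labels there. -/
theorem lt_trans {x : Word S} {e f g : Subexpr x} (hef : Lt cs e f) (hfg : Lt cs f g) :
    Lt cs e g := by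
  obtain ⟨i, hi, hfi, hei⟩ := hef
  obtain ⟨j, hj, hgj, hfj⟩ := hfg
  rcases lt_trichotomy i j with h | rfl | h
  · exact ⟨i, fun l hl => (hj l (hl.trans h)).trans (hi l hl), (hj i h).trans hfi, hei⟩
  · rw [hfi] at hfj
    exact nomatch hfj
  · exact ⟨j, fun l hl => (hj l hl).trans (hi l (hl.trans h)), hgj, (hi j h).symm.trans hfj⟩

theorem lt_or_lt_of_labels_ne {x : Word S} {e f : Subexpr x} (h : labels cs e ≠ labels cs f) :
    Lt cs e f ∨ Lt cs f e := by
  classical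
  have hex : ∃ i : ℕ, (labels cs e)[i]? ≠ (labels cs f)[i]? := by
    by_contra! h'
    exact h (List.ext_getElem? h')
  have hmin : ∀ j < Nat.find hex, (labels cs e)[j]? = (labels cs f)[j]? :=
    fun j hj => not_not.mp (Nat.find_min hex hj)
  have hne := Nat.find_spec hex
  -- Both lists have the length of `x`, so at the first difference both have genuine entries, one
  -- $U$ and one $D$.
  have hi : Nat.find hex < x.length := by
    by_contra! hi
    rw [List.getElem?_eq_none (by rwa [length_labels]),
      List.getElem?_eq_none (by rwa [length_labels])] at hne
    exact hne rfl
  generalize Nat.find hex = i at hmin hne hi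
  have he := List.getElem?_eq_getElem (l := labels cs e) (i := i) (by rwa [length_labels])
  have hf := List.getElem?_eq_getElem (l := labels cs f) (i := i) (by rwa [length_labels])
  generalize (labels cs e)[i]'(by rwa [length_labels]) = a at he
  generalize (labels cs f)[i]'(by rwa [length_labels]) = b at hf
  cases a <;> cases b
  · exact absurd (he.trans hf.symm) hne
  · exact Or.inl ⟨i, fun j hj => (hmin j hj).symm, hf, he⟩
  · exact Or.inr ⟨i, hmin, he, hf⟩
  · exact absurd (he.trans hf.symm) hne

end Subexpr

/-- Since $(ws)s=w$, the two labels compare the same pair of lengths in opposite order, and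
$\ell(ws)\neq\ell(w)$. -/
theorem label_mul_simple_ne (w : W) (s : S) : label cs (w * cs.simple s) s ≠ label cs w s := by
  have h := cs.length_mul_simple_ne w s
  unfold label
  rw [cs.simple_mul_simple_cancel_right]
  split_ifs <;> first | omega | simp

/-- A subexpression of a given element is determined by its labels. -/
theorem Subexpr.eq_of_labels_eq : {x : Word S} → {e f : Subexpr x} →
    eval cs e = eval cs f → labels cs e = labels cs f → e = f
  | .nil, _, _, _, _ => rfl
  | .snoc x s, (e, a), (f, b), hw, hl => by
    obtain ⟨hl, hs⟩ := labels_snoc_eq_iff.mp hl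
    replace hw : eval cs e * (if a then cs.simple s else 1)
      = eval cs f * (if b then cs.simple s else 1) := hw
    -- If the last bits differed, the products of the shorter subexpressions would differ by $s$ on
    -- the right, forcing opposite last labels.
    have hab : a = b := by
      cases a <;> cases b <;> simp only [Bool.false_eq_true, if_true, if_false, mul_one] at hw ⊢
      · exact (label_mul_simple_ne _ _ (hw ▸ hs)).elim
      · exact (label_mul_simple_ne _ _ (hw ▸ hs.symm)).elim
    subst hab
    rw [eq_of_labels_eq (x := x) (mul_right_cancel hw) hl]

namespace Realization

/-! The element `u_x` -/

variable (ℛ : Realization k cs V)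

/-- A tensor of units is the unit of the tensor product ring. This reduces all statements about $u$
to preservation of $1$. -/
theorem uElt_eq_one : (x : Word S) → ℛ.uElt x = 1
  | .nil => rfl
  | .snoc x s => by
    rw [uElt, uElt_eq_one x]
    rfl

theorem snocTmul_zero (x : Word S) (s : S) (f : SymmetricAlgebra k V) :
    ℛ.snocTmul x s 0 f = 0 := zero_tmul (X := ℛ.B x) (Y := unit _) f

theorem tensorLetter_snocTmul {x y : Word S} (φ : BHom (ℛ.B x) (ℛ.B y)) (s : S)
    (a : (ℛ.B x).carrier) (f : SymmetricAlgebra k V) :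
    (ℛ.tensorLetter φ s).1 (ℛ.snocTmul x s a f) = ℛ.snocTmul y s (φ.1 a) f := rfl

theorem right_snoc (x : Word S) (s : S) (r : SymmetricAlgebra k V) :
    (ℛ.B (x.snoc s)).right r = ℛ.snocTmul x s 1 r := rfl

theorem idM_one (x : Word S) (s : S) : (ℛ.idM x s).1 1 = 1 :=
  (ℛ.idM_apply x s 1 1).trans (by rw [map_one, one_mul])

theorem tensorWord_one {x y : Word S} (φ : BHom (ℛ.B x) (ℛ.B y)) (h : φ.1 1 = 1) :
    (v : Word S) → (ℛ.tensorWord φ v).1 1 = 1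
  | .nil => h
  | .snoc v _ => BHom.tensorMap_one _ _ (tensorWord_one φ h v) rfl

theorem wordTensor_one (z : Word S) {x y : Word S} (φ : BHom (ℛ.B x) (ℛ.B y))
    (h : φ.1 1 = 1) : (ℛ.wordTensor z φ).1 1 = 1 := by
  rw [wordTensor, BHom.comp_apply, BHom.comp_apply, BHom.ofRingHom_one,
    BHom.tensorMap_one _ _ (BHom.id_apply 1) h, BHom.ofRingHom_one]

variable {ℛ} in
-- Each braid step is a map with $u\mapsto u$ surrounded by identities, and $u=1$.
theorem IsRex.map_one {β : ℛ.BraidMorphisms} {x y : Word S} {φ : BHom (ℛ.B x) (ℛ.B y)}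
    (h : ℛ.IsRex β x y φ) : φ.1 1 = 1 := by
  induction h with
  | refl => rfl
  | step z v s t hst hM hφ ih =>
    have hu := (β s t hst hM).map_u
    rw [uElt_eq_one, uElt_eq_one] at hu
    rw [BHom.comp_apply, ih]
    exact ℛ.tensorWord_one _ (ℛ.wordTensor_one z _ hu) v

/-- The multiplication map `R ⊗ ⋯ ⊗ R → R`. -/
theorem exists_counit : (x : Word S) → ∃ ε : (ℛ.B x).carrier →+* SymmetricAlgebra k V,
    (∀ r, ε ((ℛ.B x).left r) = r) ∧ ∀ r, ε ((ℛ.B x).right r) = r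
  | .nil => ⟨RingHom.id _, fun _ => rfl, fun _ => rfl⟩
  | .snoc x s => by
    obtain ⟨ε, hl, hr⟩ := exists_counit x
    refine ⟨ringLift (X := ℛ.B x) (A := ℛ.fixed s) (Y := unit _) ε (RingHom.id _)
      (fun r _ => hr r), fun r => ?_, fun r => ?_⟩
    · exact (ringLift_tmul ..).trans ((mul_one _).trans (hl r))
    · exact (ringLift_tmul ..).trans ((congrArg (· * r) (map_one ε)).trans (one_mul r))

/-- Multiplication retracts $R\to B_{\underline{x}}$. Together with its right-hand analogue, this
makes the diagonal entries of the triangular matrix detect their coefficients. -/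
theorem left_injective (x : Word S) : Function.Injective (ℛ.B x).left := by
  obtain ⟨ε, hl, -⟩ := ℛ.exists_counit x
  exact Function.LeftInverse.injective hl

theorem right_injective (x : Word S) : Function.Injective (ℛ.B x).right := by
  obtain ⟨ε, -, hr⟩ := ℛ.exists_counit x
  exact Function.LeftInverse.injective hr

/-! The elements `b_{x,e}` -/

variable (δ : S → V)

theorem bElt_snoc_U {x : Word S} {s : S} {e : Subexpr (x.snoc s)}
    (h : label cs (Subexpr.eval cs (x := x) e.1) s = .U) :
    ℛ.bElt δ e = ℛ.snocTmul x s (ℛ.bElt δ e.1) 1 := by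
  rw [bElt, h]

theorem bElt_snoc_D {x : Word S} {s : S} {e : Subexpr (x.snoc s)}
    (h : label cs (Subexpr.eval cs (x := x) e.1) s = .D) :
    ℛ.bElt δ e = ℛ.snocTmul x s (ℛ.bElt δ e.1 * (ℛ.B x).right (vec k (δ s))) 1 := by
  rw [bElt, h]

/-- A shape common to both labels, so that vanishing can be propagated without knowing the last one.
-/
theorem exists_bElt_snoc {x : Word S} {s : S} (e : Subexpr (x.snoc s)) :
    ∃ r, ℛ.bElt δ e = ℛ.snocTmul x s (ℛ.bElt δ (x := x) e.1 * (ℛ.B x).right r) 1 := by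
  cases h : label cs (Subexpr.eval cs (x := x) e.1) s with
  | U => exact ⟨1, by rw [bElt_snoc_U ℛ δ h, map_one, mul_one]⟩
  | D => exact ⟨_, bElt_snoc_D ℛ δ h⟩

/-- The last letter only multiplies on the right by an element of $R$, with which bimodule maps
commute. -/
theorem tensorLetter_bElt_eq_zero {x y : Word S} (φ : BHom (ℛ.B x) (ℛ.B y)) (s : S)
    (f : Subexpr (x.snoc s)) (h : φ.1 (ℛ.bElt δ (x := x) f.1) = 0) :
    (ℛ.tensorLetter φ s).1 (ℛ.bElt δ f) = 0 := by
  obtain ⟨r, hr⟩ := ℛ.exists_bElt_snoc δ f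
  rw [hr, tensorLetter_snocTmul, BHom.map_mul_right, h, zero_mul, snocTmul_zero]

theorem bElt_congr : {x : Word S} → {e f : Subexpr x} →
    Subexpr.labels cs e = Subexpr.labels cs f → ℛ.bElt δ e = ℛ.bElt δ f
  | .nil, _, _, _ => rfl
  | .snoc x s, e, f, h => by
    obtain ⟨h₁, h₂⟩ := Subexpr.labels_snoc_eq_iff.mp h
    rw [bElt, bElt, h₂, bElt_congr (x := x) h₁]

/-! Values of light leaves -/

variable [IsDomain k] [Module.Free k V]

/-- Constants are $s$-invariant. This zero, against $\partial_s(\delta_s)=1$, is what separates the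
two labels. -/
theorem demazure_one (s : S) : ℛ.demazure s 1 = 0 := by
  apply ℛ.vec_root_cancel s
  rw [root_mul_demazure, map_one, sub_self, mul_zero]

theorem demazure_vec (s : S) {v : V} (hv : ℛ.coroot s v = 1) : ℛ.demazure s (vec k v) = 1 := by
  apply ℛ.vec_root_cancel s
  rw [root_mul_demazure, act, SymmetricAlgebra.lift_ι_apply, LinearMap.comp_apply, ℛ.rep_simple,
    hv, one_smul, map_sub, sub_sub_cancel, mul_one]

/-- The right copy of $f$ in $B_{(\underline{t},s)}$ is $1\otimes f$, so $f$ occupies the middle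
factor, on which $\partial_s$ acts. -/
theorem idI₀_of_demazure_zero (t : Word S) (s : S) {f : SymmetricAlgebra k V}
    (hf : ℛ.demazure s f = 0) (g : SymmetricAlgebra k V) :
    (ℛ.idI₀ t s).1 (ℛ.snocTmul _ s ((ℛ.B (t.snoc s)).right f) g) = 0 := by
  rw [right_snoc, idI₀_apply, hf, map_zero, mul_zero, snocTmul_zero]

theorem idI₀_of_demazure_one (t : Word S) (s : S) {f : SymmetricAlgebra k V}
    (hf : ℛ.demazure s f = 1) :
    (ℛ.idI₀ t s).1 (ℛ.snocTmul _ s ((ℛ.B (t.snoc s)).right f) 1) = 1 := by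
  rw [right_snoc, idI₀_apply, hf, map_one, mul_one]
  rfl

variable {ℛ} {δ}

/-- Induction along the construction: each test letter is chosen so that the next step returns the
unit, with $\partial_s(\delta_s)=1$ used at label $D$. -/
theorem IsLightLeaf.map_bElt {β : ℛ.BraidMorphisms} (hδ : ∀ s, ℛ.coroot s (δ s) = 1)
    {x y : Word S} {e : Subexpr x} {φ : BHom (ℛ.B x) (ℛ.B y)} (h : ℛ.IsLightLeaf β e y φ) :
    φ.1 (ℛ.bElt δ e) = 1 := by
  induction h with
  | nil => rfl
  | @U0 x e _ _ s hφ hU _ hy' _ hρ ih =>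
    refine (congrArg _ (ℛ.bElt_snoc_U δ (e := (e, false)) hU)).trans ?_
    rw [BHom.comp_apply, BHom.comp_apply, tensorLetter_snocTmul, ih,
      idM_apply, map_one, one_mul, hρ.map_one]
  | @U1 x e _ _ s hφ hU _ hy' _ hρ ih =>
    refine (congrArg _ (ℛ.bElt_snoc_U δ (e := (e, true)) hU)).trans ?_
    rw [BHom.comp_apply, tensorLetter_snocTmul, ih]
    exact hρ.map_one
  | @D0 x e _ _ s hφ hD _ ht _ hρ _ hy' _ hρ' ih =>
    refine (congrArg _ (ℛ.bElt_snoc_D δ (e := (e, false)) hD)).trans ?_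
    rw [BHom.comp_apply, BHom.comp_apply, BHom.comp_apply,
      tensorLetter_snocTmul, tensorLetter_snocTmul, BHom.map_mul_right, ih, one_mul,
      BHom.map_right_of_map_one _ hρ.map_one, idI₀_of_demazure_one ℛ _ s (ℛ.demazure_vec s (hδ s)), hρ'.map_one]
  | @D1 x e _ _ s hφ hD _ ht _ hρ _ hy' _ hρ' ih =>
    refine (congrArg _ (ℛ.bElt_snoc_D δ (e := (e, true)) hD)).trans ?_
    rw [BHom.comp_apply, BHom.comp_apply, BHom.comp_apply,
      tensorLetter_snocTmul, tensorLetter_snocTmul, BHom.map_mul_right, ih, one_mul,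
      BHom.map_right_of_map_one _ hρ.map_one, idI₁, BHom.comp_apply,
      idI₀_of_demazure_one ℛ _ s (ℛ.demazure_vec s (hδ s)), idM_one, hρ'.map_one]

/-- Induction along the construction: a difference at an earlier letter gives a zero that persists,
and a difference at the last letter can only occur when the leaf has label $D$ there. -/
theorem IsLightLeaf.map_bElt_of_lt {β : ℛ.BraidMorphisms} (hδ : ∀ s, ℛ.coroot s (δ s) = 1)
    {x y : Word S} {e : Subexpr x} {φ : BHom (ℛ.B x) (ℛ.B y)} (h : ℛ.IsLightLeaf β e y φ)
    (f : Subexpr x) (hf : f.Lt cs e) : φ.1 (ℛ.bElt δ f) = 0 := by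
  induction h with
  | nil => exact absurd hf (Subexpr.lt_irrefl (x := .nil) ())
  | U0 s hφ hU hy' hρ ih =>
    rcases Subexpr.lt_snoc hf with hf | ⟨-, hD, -⟩
    · rw [BHom.comp_apply, BHom.comp_apply, tensorLetter_bElt_eq_zero ℛ δ _ s f (ih _ hf), map_zero,
        map_zero]
    · exact nomatch hU.symm.trans hD
  | U1 s hφ hU hy' hρ ih =>
    rcases Subexpr.lt_snoc hf with hf | ⟨-, hD, -⟩
    · rw [BHom.comp_apply, tensorLetter_bElt_eq_zero ℛ δ _ s f (ih _ hf), map_zero]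
    · exact nomatch hU.symm.trans hD
  | D0 s hφ hD ht hρ hy' hρ' ih =>
    rw [BHom.comp_apply, BHom.comp_apply, BHom.comp_apply]
    rcases Subexpr.lt_snoc hf with hf | ⟨hl, -, hU⟩
    · rw [tensorLetter_bElt_eq_zero ℛ δ _ s f (ih _ hf), map_zero, map_zero, map_zero]
    -- The earlier labels agree, so the earlier test vectors are equal and map to $1$. Writing this
    -- $1$ as the right image of $1\in R$ exposes the factor $\partial_s(1)=0$.
    · rw [bElt_snoc_U ℛ δ hU, tensorLetter_snocTmul, tensorLetter_snocTmul, ← bElt_congr ℛ δ hl,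
        hφ.map_bElt hδ, hρ.map_one, ← map_one (ℛ.B _).right,
        idI₀_of_demazure_zero ℛ _ s (ℛ.demazure_one s), map_zero]
  | D1 s hφ hD ht hρ hy' hρ' ih =>
    rw [BHom.comp_apply, BHom.comp_apply, BHom.comp_apply]
    rcases Subexpr.lt_snoc hf with hf | ⟨hl, -, hU⟩
    · rw [tensorLetter_bElt_eq_zero ℛ δ _ s f (ih _ hf), map_zero, map_zero, map_zero]
    · rw [bElt_snoc_U ℛ δ hU, tensorLetter_snocTmul, tensorLetter_snocTmul, ← bElt_congr ℛ δ hl,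
        hφ.map_bElt hδ, hρ.map_one, ← map_one (ℛ.B _).right, idI₁, BHom.comp_apply,
        idI₀_of_demazure_zero ℛ _ s (ℛ.demazure_one s), map_zero, map_zero]

end Realization

/-! ### Linear independence from triangularity -/

/-- Unitriangularity implies independence: if `c e • L e f` sums to `0` over `e` for all `f`, where
the matrix `L` is triangular for a strict total order with `c • L e e = 0 → c = 0`, then `c = 0`. -/
theorem eq_zero_of_triangular {ι R N : Type*} [Zero R] [AddCommMonoid N] (r : ι → ι → Prop)
    (irrefl : ∀ i, ¬ r i i) (trans : ∀ i j l, r i j → r j l → r i l)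
    (total : ∀ i j, i ≠ j → r i j ∨ r j i) (L : R → ι → ι → N) (zero : ∀ i j, L 0 i j = 0)
    (triangular : ∀ c i j, r j i → L c i j = 0) (diagonal : ∀ c i, L c i i = 0 → c = 0)
    (T : Finset ι) (c : ι → R) (h : ∀ j, ∑ i ∈ T, L (c i) i j = 0) : ∀ i ∈ T, c i = 0 := by
  by_contra! hne
  have : IsStrictOrder ι r := { irrefl, trans }
  have hfin : {i | i ∈ T ∧ c i ≠ 0}.Finite := T.finite_toSet.subset fun i hi => hi.1
  -- With `j` minimal in the support of `c`, every other index of the support lies above `j`, so its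
  -- term vanishes at `j` and only the diagonal one remains.
  obtain ⟨j, hj, hmin⟩ := (hfin.wellFoundedOn (r := r)).has_min Set.univ
    (hne.elim fun i hi => ⟨⟨i, hi⟩, trivial⟩)
  refine j.2.2 (diagonal (c j) j ?_)
  rw [← h j]
  refine (Finset.sum_eq_single_of_mem (f := fun i => L (c i) i j.1) j.1 j.2.1 fun i hi hij => ?_).symm
  by_cases hc : c i = 0
  · rw [hc, zero]
  · exact triangular _ _ _ ((total i j hij).resolve_left (hmin ⟨i, hi, hc⟩ trivial))

end Support

end LightLeaf

theorem mainTheorem10 {k : Type*} [CommRing k] [IsDomain k] [IsNoetherianRing k]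
    {W : Type*} [Group W] {S : Type*} [Finite S] {M : CoxeterMatrix S} (cs : CoxeterSystem M W)
    {V : Type*} [AddCommGroup V] [Module k V] [Module.Free k V] [Module.Finite k V]
    (ℛ : LightLeaf.Realization k cs V) (β : ℛ.BraidMorphisms)
    (δ : S → V) (hδ : ∀ s, ℛ.coroot s (δ s) = 1)
    (x : LightLeaf.Word S) (w : W)
    (wbar : LightLeaf.Word S) (hwbar : LightLeaf.IsReducedExpr cs wbar w)
    (LL : {e : LightLeaf.Subexpr x // e.eval cs = w} → LightLeaf.BHom (ℛ.B x) (ℛ.B wbar))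
    (hLL : ∀ e, ℛ.IsLightLeaf β e.1 wbar (LL e)) :
    (∀ e : {e : LightLeaf.Subexpr x // e.eval cs = w}, (LL e).1 (ℛ.bElt δ e.1) = ℛ.uElt wbar) ∧
    (∀ e f : {e : LightLeaf.Subexpr x // e.eval cs = w}, f.1.Lt cs e.1 → (LL e).1 (ℛ.bElt δ f.1) = 0) ∧
    LinearIndependent (SymmetricAlgebra k V) LL ∧
    (∀ (T : Finset {e : LightLeaf.Subexpr x // e.eval cs = w})
      (c : {e : LightLeaf.Subexpr x // e.eval cs = w} → SymmetricAlgebra k V),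
      (∀ m, ∑ e ∈ T, (LL e).1 (m * (ℛ.B x).right (c e)) = 0) → ∀ e ∈ T, c e = 0) := by
  have hu : ∀ e : {e : LightLeaf.Subexpr x // e.eval cs = w}, (LL e).1 (ℛ.bElt δ e.1) = 1 :=
    fun e => (hLL e).map_bElt hδ
  have hlt : ∀ e f : {e : LightLeaf.Subexpr x // e.eval cs = w}, f.1.Lt cs e.1 →
      (LL e).1 (ℛ.bElt δ f.1) = 0 := fun e f h => (hLL e).map_bElt_of_lt hδ f.1 h
  -- Distinct indices have the same product $w$, hence different labels, and the first difference
  -- decides the order.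
  have total : ∀ e f : {e : LightLeaf.Subexpr x // e.eval cs = w}, e ≠ f →
      e.1.Lt cs f.1 ∨ f.1.Lt cs e.1 := fun e f h =>
    LightLeaf.Subexpr.lt_or_lt_of_labels_ne fun hl =>
      h (Subtype.ext (LightLeaf.Subexpr.eq_of_labels_eq (e.2.trans f.2.symm) hl))
  refine ⟨fun e => (hu e).trans (ℛ.uElt_eq_one wbar).symm, hlt, ?_, fun T c hc => ?_⟩
  · rw [linearIndependent_iff'ₛ]
    intro T c d hcd e he
    -- The criterion compares two families of coefficients; triangularity is applied to their
    -- difference.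
    refine sub_eq_zero.mp ?_
    revert e
    refine LightLeaf.eq_zero_of_triangular (fun f e => f.1.Lt cs e.1)
      (fun e => LightLeaf.Subexpr.lt_irrefl e.1) (fun _ _ _ => LightLeaf.Subexpr.lt_trans) total
      (fun r e f => (ℛ.B wbar).left r * (LL e).1 (ℛ.bElt δ f.1))
      (fun e f => by rw [map_zero, zero_mul]) (fun r e f h => by rw [hlt e f h, mul_zero])
      (fun r e h => ?_) T (fun e => c e - d e) fun f => ?_
    · rw [hu, mul_one] at h
      exact (map_eq_zero_iff _ (ℛ.left_injective wbar)).mp h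
    · have h := congrArg (fun φ : LightLeaf.BHom (ℛ.B x) (ℛ.B wbar) => φ.1 (ℛ.bElt δ f.1)) hcd
      simp only [Submodule.coe_sum, LinearMap.sum_apply] at h
      simp only [map_sub, sub_mul, Finset.sum_sub_distrib]
      exact sub_eq_zero.mpr h
  · refine LightLeaf.eq_zero_of_triangular (fun f e => f.1.Lt cs e.1)
      (fun e => LightLeaf.Subexpr.lt_irrefl e.1) (fun _ _ _ => LightLeaf.Subexpr.lt_trans) total
      -- For the right structure the coefficient sits inside the argument. It comes out on the right
      -- by bimodule linearity.
      (fun r e f => (LL e).1 (ℛ.bElt δ f.1 * (ℛ.B x).right r))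
      (fun e f => by rw [map_zero, mul_zero, map_zero])
      (fun r e f h => by rw [LightLeaf.BHom.map_mul_right, hlt e f h, zero_mul])
      (fun r e h => ?_) T c fun f => hc (ℛ.bElt δ f.1)
    rw [LightLeaf.BHom.map_mul_right, hu, one_mul] at h
    exact (map_eq_zero_iff _ (ℛ.right_injective wbar)).mp h
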